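/- Let $\mathfrak{g}$ be a complex Lie algebra (possibly infinite dimensional) and $\mathfrak{n}$ a Lie subalgebra of $\mathfrak{g}$. An $\mathfrak{n}$-module $V$ is called locally finite over $\mathfrak{n}$ if $\dim U(\mathfrak{n})v<\infty$ for every $v\in V$. For a finite dimensional $\mathfrak{n}$-module $X$ and a simple finite dimensional $\mathfrak{n}$-module $L$ let $[X:L]$ be the multiplicity of $L$ in a composition series of $X$; for a locally finite $\mathfrak{n}$-module $V$ let $[V:L]\in\{0,1,2,\dots,\infty\}$ be the supremum of $[F:L]$ over the finite dimensional $\mathfrak{n}$-submodules $F$ of $V$. Assume that the adjoint $\mathfrak{n}$-module $\mathfrak{g}/\mathfrak{n}$ is locally finite over $\mathfrak{n}$. Let $\mathrm{Irr}$ be the set of isomorphism classes of simple finite dimensional $\mathfrak{n}$-modules, and let $\sim$ be the smallest equivalence relation on $\mathrm{Irr}$ such that, for $L,S\in\mathrm{Irr}$: (I) $L\sim S$ if there is an indecomposable finite dimensional $\mathfrak{n}$-module $X$ with $[X:L]\neq 0$ and $[X:S]\neq 0$; (II) $L\sim S$ if $[\mathfrak{g}/\mathfrak{n}\otimes_{\mathbb{C}}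 L:S]\neq 0$. Let $M$ be a $\mathfrak{g}$-module that is locally finite over $\mathfrak{n}$. For $I\in \mathrm{Irr}/{\sim}$ let $M_I\subseteq M$ be the sum of the images of all $\mathfrak{g}$-homomorphisms $U(\mathfrak{g})\otimes_{U(\mathfrak{n})}N\to M$, where $N$ runs over the finite dimensional $\mathfrak{n}$-modules such that, for every simple finite dimensional $\mathfrak{n}$-module $L$, $[N:L]\neq 0$ implies $L\in I$. Then: (i) For every $I\in \mathrm{Irr}/{\sim}$ the vector space $M_I$ is a $\mathfrak{g}$-submodule of $M$, and for every simple finite dimensional $\mathfrak{n}$-module $L$, $[M_I:L]\neq 0$ implies $L\in I$. (ii) $M=\bigoplus_{I\in \mathrm{Irr}/{\sim}} M_I$. (iii) If $I,J\in \mathrm{Irr}/{\sim}$ and $I\neq J$, then $\mathrm{Hom}_{\mathfrak{g}}(M_I,M_J)=0$. -/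

import Mathlib

open scoped TensorProduct

noncomputable section

namespace LieBlocks

/-! ### Modules over a complex Lie algebra -/

section Modules

variable (𝔨 : Type*) [LieRing 𝔨] [LieAlgebra ℂ 𝔨]

/-- The action of the universal enveloping algebra `U(𝔨)` on a `𝔨`-module. -/
def envAct (V : Type*) [AddCommGroup V] [Module ℂ V] [LieRingModule 𝔨 V] [LieModule ℂ 𝔨 V] :
    UniversalEnvelopingAlgebra ℂ 𝔨 →ₐ[ℂ] Module.End ℂ V :=
  UniversalEnvelopingAlgebra.lift ℂ (LieModule.toEnd ℂ 𝔨 V)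

/-- The subspace `U(𝔨) v` of a `𝔨`-module. -/
def envOrbit {V : Type*} [AddCommGroup V] [Module ℂ V] [LieRingModule 𝔨 V] [LieModule ℂ 𝔨 V]
    (v : V) : Submodule ℂ V :=
  LinearMap.range ((envAct 𝔨 V).toLinearMap.flip v)

/-- The action of `𝔨` on `V` is locally finite: `U(𝔨) v` is finite dimensional for every `v`. -/
def IsLocallyFinite (V : Type*) [AddCommGroup V] [Module ℂ V] [LieRingModule 𝔨 V]
    [LieModule ℂ 𝔨 V] : Prop :=
  ∀ v : V, FiniteDimensional ℂ (envOrbit 𝔨 v)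

/-- A module is indecomposable if it is nonzero and is not the direct sum of two nonzero
submodules. -/
def IsIndecomposable (V : Type*) [AddCommGroup V] [Module ℂ V] [LieRingModule 𝔨 V]
    [LieModule ℂ 𝔨 V] : Prop :=
  Nontrivial V ∧ ∀ A B : LieSubmodule ℂ 𝔨 V, IsCompl A B → A = ⊥ ∨ B = ⊥

/-- The number of factors isomorphic to `L` in the chain `s` of submodules of `V`. -/
def factorCount {V : Type*} [AddCommGroup V] [Module ℂ V] [LieRingModule 𝔨 V] [LieModule ℂ 𝔨 V]
    (s : CompositionSeries (LieSubmodule ℂ 𝔨 V))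
    (L : Type*) [AddCommGroup L] [Module ℂ L] [LieRingModule 𝔨 L] [LieModule ℂ 𝔨 L] : ℕ∞ :=
  Set.encard {i : Fin s.length |
    Nonempty (L ≃ₗ⁅ℂ,𝔨⁆ (s i.succ) ⧸ (s i.castSucc).comap (s i.succ).incl)}

/-- The multiplicity `[X : L]` of a simple module `L` in a finite dimensional module `X`: the
number of factors isomorphic to `L` in a composition series of `X`. (The supremum is over all
composition series of `X`; by the Jordan-Hölder theorem they all give the same value.) -/
def finMult (X : Type*) [AddCommGroup X] [Module ℂ X] [LieRingModule 𝔨 X] [LieModule ℂ 𝔨 X]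
    (L : Type*) [AddCommGroup L] [Module ℂ L] [LieRingModule 𝔨 L] [LieModule ℂ 𝔨 L] : ℕ∞ :=
  ⨆ s : {s : CompositionSeries (LieSubmodule ℂ 𝔨 X) // s.head = ⊥ ∧ s.last = ⊤},
    factorCount 𝔨 s.1 L

/-- The multiplicity `[V : L]` in a locally finite module `V`: the supremum of `[F : L]` over the
finite dimensional submodules `F` of `V`. These are directed, so the supremum may be computed
along any exhausting filtration of `V` by finite dimensional submodules. -/
def mult (V : Type*) [AddCommGroup V] [Module ℂ V] [LieRingModule 𝔨 V] [LieModule ℂ 𝔨 V]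
    (L : Type*) [AddCommGroup L] [Module ℂ L] [LieRingModule 𝔨 L] [LieModule ℂ 𝔨 L] : ℕ∞ :=
  ⨆ F : {F : LieSubmodule ℂ 𝔨 V // FiniteDimensional ℂ F}, finMult 𝔨 F.1 L

/-- Simple finite dimensional `𝔨`-modules. Every finite dimensional complex `𝔨`-module, in
whatever universe, is isomorphic to one whose carrier (for instance `Fin n → ℂ`) is in `Type`. -/
structure SimpleFD where
  carrier : Type
  [addCommGroup : AddCommGroup carrier]
  [module : Module ℂ carrier]
  [lieRingModule : LieRingModule 𝔨 carrier]
  [lieModule : LieModule ℂ 𝔨 carrier]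
  [finiteDimensional : FiniteDimensional ℂ carrier]
  [irreducible : LieModule.IsIrreducible ℂ 𝔨 carrier]

attribute [instance] SimpleFD.addCommGroup SimpleFD.module SimpleFD.lieRingModule
  SimpleFD.lieModule SimpleFD.finiteDimensional SimpleFD.irreducible

/-- Isomorphism of simple finite dimensional modules. -/
instance isoSetoid : Setoid (SimpleFD 𝔨) where
  r L S := Nonempty (L.carrier ≃ₗ⁅ℂ,𝔨⁆ S.carrier)
  iseqv :=
    { refl := fun _ => ⟨LieModuleEquiv.refl⟩
      symm := fun ⟨e⟩ => ⟨e.symm⟩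
      trans := fun ⟨e⟩ ⟨f⟩ => ⟨e.trans f⟩ }

/-- The set of isomorphism classes of simple finite dimensional `𝔨`-modules. -/
def Irr : Type _ := Quotient (isoSetoid 𝔨)

/-- The isomorphism class of a simple finite dimensional module. -/
def SimpleFD.cls {𝔨 : Type*} [LieRing 𝔨] [LieAlgebra ℂ 𝔨] (L : SimpleFD 𝔨) : Irr 𝔨 :=
  Quotient.mk (isoSetoid 𝔨) L

end Modules

/-! ### Induction from a subalgebra -/

section Induction

attribute [local instance 100] LieRing.ofAssociativeRing

variable {𝔤 : Type*} [LieRing 𝔤] [LieAlgebra ℂ 𝔤] (𝔫 : LieSubalgebra ℂ 𝔤)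

/-- The algebra homomorphism `U(𝔫) → U(𝔤)` given by the inclusion of `𝔫` in `𝔤`. -/
def envIncl : UniversalEnvelopingAlgebra ℂ 𝔫 →ₐ[ℂ] UniversalEnvelopingAlgebra ℂ 𝔤 :=
  UniversalEnvelopingAlgebra.lift ℂ ((UniversalEnvelopingAlgebra.ι ℂ).comp 𝔫.incl)

variable (N : Type*) [AddCommGroup N] [Module ℂ N] [LieRingModule 𝔫 N] [LieModule ℂ 𝔫 N]

/-- The `U(𝔤)`-submodule of `U(𝔤) ⊗[ℂ] N` generated by all
`(u w) ⊗ v - u ⊗ (w v)` with `u ∈ U(𝔤)`, `w ∈ U(𝔫)`, `v ∈ N`. -/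
def balancedRel :
    Submodule (UniversalEnvelopingAlgebra ℂ 𝔤) (UniversalEnvelopingAlgebra ℂ 𝔤 ⊗[ℂ] N) :=
  Submodule.span (UniversalEnvelopingAlgebra ℂ 𝔤)
    {t | ∃ (u : UniversalEnvelopingAlgebra ℂ 𝔤) (w : UniversalEnvelopingAlgebra ℂ 𝔫) (v : N),
      t = (u * envIncl 𝔫 w) ⊗ₜ[ℂ] v - u ⊗ₜ[ℂ] (envAct 𝔫 N w v)}

/-- The induced module `U(𝔤) ⊗_{U(𝔫)} N`. -/
abbrev Ind : Type _ := (UniversalEnvelopingAlgebra ℂ 𝔤 ⊗[ℂ] N) ⧸ balancedRel 𝔫 N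

/-- `𝔤` acts on the induced module by left multiplication on `U(𝔤)`. -/
instance Ind.lieRingModule : LieRingModule 𝔤 (Ind 𝔫 N) where
  bracket x m := UniversalEnvelopingAlgebra.ι ℂ x • m
  add_lie x y m := by
    change UniversalEnvelopingAlgebra.ι ℂ (x + y) • m = _ • m + _ • m
    rw [map_add, add_smul]
  lie_add x m n := smul_add _ m n
  leibniz_lie x y m := by
    change UniversalEnvelopingAlgebra.ι ℂ x • UniversalEnvelopingAlgebra.ι ℂ y • m
      = UniversalEnvelopingAlgebra.ι ℂ ⁅x, y⁆ • m
        + UniversalEnvelopingAlgebra.ι ℂ y • UniversalEnvelopingAlgebra.ι ℂ x • m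
    rw [LieHom.map_lie, LieRing.of_associative_ring_bracket, sub_smul, mul_smul, mul_smul]
    abel

instance Ind.lieModule : LieModule ℂ 𝔤 (Ind 𝔫 N) where
  smul_lie c x m := by
    change UniversalEnvelopingAlgebra.ι ℂ (c • x) • m = c • UniversalEnvelopingAlgebra.ι ℂ x • m
    rw [map_smul, smul_assoc]
  lie_smul c x m := by
    change UniversalEnvelopingAlgebra.ι ℂ x • c • m = c • UniversalEnvelopingAlgebra.ι ℂ x • m
    rw [smul_comm]

end Induction

/-! ### The equivalence relation and the traces -/

section Blocks

variable {𝔤 : Type*} [LieRing 𝔤] [LieAlgebra ℂ 𝔤] (𝔫 : LieSubalgebra ℂ 𝔤)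

/-- The adjoint `𝔫`-module `𝔤/𝔫`. -/
abbrev AdjQuot : Type _ := 𝔤 ⧸ 𝔫.toLieSubmodule

/-- The first generating relation: `L` and `S` both occur in some indecomposable finite
dimensional `𝔫`-module. -/
def ShareIndecomposable (L S : SimpleFD 𝔫) : Prop :=
  ∃ (X : Type) (_ : AddCommGroup X) (_ : Module ℂ X) (_ : LieRingModule 𝔫 X)
    (_ : LieModule ℂ 𝔫 X), FiniteDimensional ℂ X ∧ IsIndecomposable 𝔫 X ∧
      finMult 𝔫 X L.carrier ≠ 0 ∧ finMult 𝔫 X S.carrier ≠ 0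

/-- The second generating relation: `[𝔤/𝔫 ⊗ L : S] ≠ 0`. -/
def OccursInTensor (L S : SimpleFD 𝔫) : Prop :=
  mult 𝔫 (AdjQuot 𝔫 ⊗[ℂ] L.carrier) S.carrier ≠ 0

/-- The union of the two generating relations, on isomorphism classes. -/
def Linked (a b : Irr 𝔫) : Prop :=
  ∃ L S : SimpleFD 𝔫, L.cls = a ∧ S.cls = b ∧ (ShareIndecomposable 𝔫 L S ∨ OccursInTensor 𝔫 L S)

/-- The smallest equivalence relation on `Irr 𝔫` containing both generating relations. -/
def blockSetoid : Setoid (Irr 𝔫) := Relation.EqvGen.setoid (Linked 𝔫)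

/-- The set of equivalence classes of simple finite dimensional `𝔫`-modules. -/
def Block : Type _ := Quotient (blockSetoid 𝔫)

/-- `L ∈ I`, for a simple finite dimensional `𝔫`-module `L` (in any universe): the isomorphism
class of `L` belongs to the equivalence class `I`. -/
def Belongs (L : Type*) [AddCommGroup L] [Module ℂ L] [LieRingModule 𝔫 L] [LieModule ℂ 𝔫 L]
    (I : Block 𝔫) : Prop :=
  ∃ S : SimpleFD 𝔫, Nonempty (L ≃ₗ⁅ℂ,𝔫⁆ S.carrier) ∧ Quotient.mk (blockSetoid 𝔫) S.cls = I

/-- A finite dimensional `𝔫`-module `N` such that `[N : L] ≠ 0` implies `L ∈ I`. -/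
def HasFactorsIn (N : Type) [AddCommGroup N] [Module ℂ N] [LieRingModule 𝔫 N] [LieModule ℂ 𝔫 N]
    (I : Block 𝔫) : Prop :=
  FiniteDimensional ℂ N ∧
    ∀ L : SimpleFD 𝔫, finMult 𝔫 N L.carrier ≠ 0 → Belongs 𝔫 L.carrier I

/-- The subspace `M_I`: the sum of the images of all `𝔤`-homomorphisms to `M` from the modules
induced from finite dimensional `𝔫`-modules with all composition factors in `I`. -/
def traceSubspace (M : Type*) [AddCommGroup M] [Module ℂ M] [LieRingModule 𝔤 M] [LieModule ℂ 𝔤 M]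
    (I : Block 𝔫) : Submodule ℂ M :=
  ⨆ (N : Type) (_ : AddCommGroup N) (_ : Module ℂ N) (_ : LieRingModule 𝔫 N)
    (_ : LieModule ℂ 𝔫 N) (_ : HasFactorsIn 𝔫 N I) (φ : Ind 𝔫 N →ₗ⁅ℂ,𝔤⁆ M),
    LinearMap.range (φ : Ind 𝔫 N →ₗ[ℂ] M)

end Blocks

end LieBlocks

end

open scoped TensorProduct

noncomputable section

namespace LieBlocks

/-! ### Subquotients -/

section Subquotients

set_option linter.unusedSectionVars false

variable (𝔨 : Type*) [LieRing 𝔨] [LieAlgebra ℂ 𝔨]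

/-! Relation (I) makes `M` split over `𝔫`, and relation (II) makes the pieces stable under `𝔤`. For
a set `S` of classes of simple modules let `maxSub S M` be the sum of all `𝔫`-submodules with all
finite dimensional simple subquotients in `S`; it has the same property itself (`allIn_maxSub`). A
finite dimensional `𝔫`-module is a sum of indecomposables, and by (I) the factors of each lie in one
block, so these submodules, taken over the blocks, span `M` (`iSup_maxSub`). They are independent:
submodules attached to disjoint sets intersect in zero, since a nonzero intersection would contain a
simple module with its class in both (`disjoint_maxSub`).

For stability, let `F` be a finite dimensional `𝔫`-submodule with factors in `I`. The action induces
an `𝔫`-map from `𝔤/𝔫 ⊗ F` to `M/F`. By (II) and induction on `dim F`, the factors of `𝔤/𝔫 ⊗ F` lie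
in `I` (`allIn_adjQuot_tensor`); hence so do those of `F + 𝔤F` (`lie_mem_maxSub`). Frobenius
reciprocity then identifies the block piece with the trace `M_I`
(`blockSubmodule_eq_traceSubspace`), and a homomorphism from `M_I` to `M_J` vanishes because its
image lies in both pieces.

Only vanishing of multiplicities matters, so composition series are replaced by `Occurs`, which
passes directly through exact sequences. For irreducible `L` it agrees with nonvanishing of
`finMult` on finite dimensional modules and of `mult` on locally finite ones. -/

/-- `L` has a nonzero quotient of a submodule of `X` as a submodule: there is a submodule of
`X × L` which is the graph of a nonzero homomorphism from a submodule of `X` to `L`. For simple `L`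
this says that `L` is a subquotient of `X`. -/
def Occurs (L X : Type*) [AddCommGroup L] [Module ℂ L] [LieRingModule 𝔨 L]
    [AddCommGroup X] [Module ℂ X] [LieRingModule 𝔨 X] : Prop :=
  ∃ R : Submodule ℂ (X × L), (∀ (y : 𝔨) (x : X) (l : L), (x, l) ∈ R → (⁅y, x⁆, ⁅y, l⁆) ∈ R) ∧
    (∀ l, (0, l) ∈ R → l = 0) ∧ ∃ x l, (x, l) ∈ R ∧ l ≠ 0

variable {𝔨}

variable {L L' X Y Z : Type*}
  [AddCommGroup L] [Module ℂ L] [LieRingModule 𝔨 L] [LieModule ℂ 𝔨 L]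
  [AddCommGroup L'] [Module ℂ L'] [LieRingModule 𝔨 L'] [LieModule ℂ 𝔨 L']
  [AddCommGroup X] [Module ℂ X] [LieRingModule 𝔨 X] [LieModule ℂ 𝔨 X]
  [AddCommGroup Y] [Module ℂ Y] [LieRingModule 𝔨 Y] [LieModule ℂ 𝔨 Y]
  [AddCommGroup Z] [Module ℂ Z] [LieRingModule 𝔨 Z] [LieModule ℂ 𝔨 Z]

theorem Occurs.congr_left (e : L ≃ₗ⁅ℂ,𝔨⁆ L') (h : Occurs 𝔨 L X) : Occurs 𝔨 L' X := by
  obtain ⟨R, hR, h0, x, l, hl, hne⟩ := h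
  refine ⟨R.comap (LinearMap.id.prodMap (e.symm : L' →ₗ[ℂ] L)), fun y x l h => ?_,
    fun l h => ?_, x, e l, ?_, ?_⟩
  · have := hR y _ _ h
    rwa [Submodule.mem_comap, LinearMap.prodMap_apply, show (e.symm : L' →ₗ[ℂ] L) ⁅y, l⁆ = ⁅y, e.symm l⁆ from
      LieModuleHom.map_lie e.symm.toLieModuleHom y l]
  · simpa using h0 (e.symm l) (by simpa using h)
  · simpa using hl
  · simpa using hne

/-- If `X → Y → Z` is exact at `Y`, what occurs in `Y` occurs in `X` or in `Z`. -/
theorem Occurs.of_exact (i : X →ₗ⁅ℂ,𝔨⁆ Y) (g : Y →ₗ⁅ℂ,𝔨⁆ Z) (hig : ∀ y, g y = 0 → ∃ x, i x = y)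
    (h : Occurs 𝔨 L Y) : Occurs 𝔨 L X ∨ Occurs 𝔨 L Z := by
  obtain ⟨R, hR, h0, x, l, hl, hne⟩ := h
  -- Either the partial map is nonzero somewhere on the kernel of `g`, and pulls back to `X`, or it
  -- vanishes there, and descends to a single-valued relation on `Z`.
  by_cases hk : ∃ x l, (x, l) ∈ R ∧ g x = 0 ∧ l ≠ 0
  · left
    obtain ⟨x, l, hl, hx, hne⟩ := hk
    obtain ⟨x, rfl⟩ := hig x hx
    refine ⟨R.comap ((i : X →ₗ[ℂ] Y).prodMap LinearMap.id), fun y x l h => ?_, fun l h => ?_,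
      x, l, by simpa using hl, hne⟩
    · simpa using hR y _ _ h
    · exact h0 l (by simpa using h)
  · right
    push Not at hk
    refine ⟨R.map ((g : Y →ₗ[ℂ] Z).prodMap LinearMap.id), ?_, ?_, g x, l, ⟨(x, l), hl, rfl⟩, hne⟩
    · rintro y _ _ ⟨⟨x, l⟩, h, h'⟩
      obtain ⟨rfl, rfl⟩ := Prod.ext_iff.1 h'
      exact ⟨(⁅y, x⁆, ⁅y, l⁆), hR y _ _ h, by simp⟩
    · rintro l ⟨⟨x, l'⟩, h, h'⟩
      obtain ⟨h1, rfl⟩ := Prod.ext_iff.1 h'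
      exact hk x _ h h1

theorem not_occurs_of_subsingleton [Subsingleton X] : ¬ Occurs 𝔨 L X := by
  rintro ⟨R, hR, h0, x, l, hl, hne⟩
  exact hne (h0 l (by rwa [Subsingleton.elim 0 x]))

theorem Occurs.of_injective (g : X →ₗ⁅ℂ,𝔨⁆ Y) (hg : Function.Injective g) (h : Occurs 𝔨 L X) :
    Occurs 𝔨 L Y :=
  (h.of_exact (⊥ : LieSubmodule ℂ 𝔨 X).incl g fun _ hy =>
    ⟨0, ((map_eq_zero_iff g hg).1 hy).symm⟩).resolve_left not_occurs_of_subsingleton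

theorem Occurs.of_surjective (g : X →ₗ⁅ℂ,𝔨⁆ Y) (hg : Function.Surjective g) (h : Occurs 𝔨 L Y) :
    Occurs 𝔨 L X :=
  (h.of_exact g (0 : Y →ₗ⁅ℂ,𝔨⁆ (⊥ : LieSubmodule ℂ 𝔨 Y)) fun y _ => hg y).resolve_right not_occurs_of_subsingleton

theorem Occurs.mono {A B : LieSubmodule ℂ 𝔨 X} (hAB : A ≤ B) (h : Occurs 𝔨 L A) :
    Occurs 𝔨 L B :=
  h.of_injective (LieSubmodule.inclusion hAB) (LieSubmodule.inclusion_injective hAB)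

theorem Occurs.of_submodule {A : LieSubmodule ℂ 𝔨 X} (h : Occurs 𝔨 L A) : Occurs 𝔨 L X :=
  h.of_injective A.incl Subtype.val_injective

/-- If `X → Y → W` is exact at `Y` and the image of `Z → W` contains that of `Y → W`, what occurs
in `Y` occurs in `X` or in `Z`. -/
theorem Occurs.of_exact_range {W : Type*} [AddCommGroup W] [Module ℂ W] [LieRingModule 𝔨 W]
    [LieModule ℂ 𝔨 W] (i : X →ₗ⁅ℂ,𝔨⁆ Y) (g : Y →ₗ⁅ℂ,𝔨⁆ W) (g' : Z →ₗ⁅ℂ,𝔨⁆ W)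
    (hig : ∀ y, g y = 0 → ∃ x, i x = y) (hg : ∀ y, ∃ z, g' z = g y) (h : Occurs 𝔨 L Y) :
    Occurs 𝔨 L X ∨ Occurs 𝔨 L Z := by
  -- Replacing `W` by the image of `g'` makes that image a quotient of `Z`.
  refine (h.of_exact i (g.codRestrict g'.range fun y => (LieModuleHom.mem_range _ _).2 (hg y))
    fun y hy => hig y (congrArg Subtype.val hy)).imp_right fun h => ?_
  refine h.of_surjective (g'.codRestrict g'.range fun z => (LieModuleHom.mem_range _ _).2 ⟨z, rfl⟩)
    fun w => ?_
  obtain ⟨z, hz⟩ := (LieModuleHom.mem_range _ _).1 w.2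
  exact ⟨z, Subtype.ext hz⟩

/-- Whatever occurs in the sum of two submodules occurs in one of them. -/
theorem Occurs.of_sup {A B : LieSubmodule ℂ 𝔨 X} (h : Occurs 𝔨 L ↥(A ⊔ B)) :
    Occurs 𝔨 L A ∨ Occurs 𝔨 L B := by
  refine h.of_exact_range (LieSubmodule.inclusion (le_sup_left : A ≤ A ⊔ B))
    ((LieSubmodule.Quotient.mk' A).comp (A ⊔ B).incl) ((LieSubmodule.Quotient.mk' A).comp B.incl)
    (fun y hy => ⟨⟨y, (LieSubmodule.Quotient.mk_eq_zero A).1 hy⟩, rfl⟩) fun y => ?_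
  obtain ⟨a, ha, b, hb, hab⟩ := (LieSubmodule.mem_sup _ _ _).1 y.2
  refine ⟨⟨b, hb⟩, (sub_eq_zero.1 ?_).symm⟩
  have : (LieSubmodule.Quotient.mk' A) (y - b : X) = 0 :=
    (LieSubmodule.Quotient.mk_eq_zero A).2 (by rwa [← hab, add_sub_cancel_right])
  rwa [map_sub] at this

/-- If every element of `X` lies in a submodule of a given kind, then what occurs in `X` occurs in
a submodule of this kind. -/
theorem Occurs.exists_of_cover {p : LieSubmodule ℂ 𝔨 X → Prop} (hp : ∀ x, ∃ F, p F ∧ x ∈ F)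
    (h : Occurs 𝔨 L X) : ∃ F, p F ∧ Occurs 𝔨 L F := by
  obtain ⟨R, hR, h0, x, l, hl, hne⟩ := h
  -- One element `x` with nonzero image witnesses the occurrence, so any submodule containing `x`
  -- will do.
  obtain ⟨F, hF, hx⟩ := hp x
  refine ⟨F, hF, R.comap ((F.incl : F →ₗ[ℂ] X).prodMap LinearMap.id), fun y x l h => ?_,
    fun l h => ?_, ⟨x, hx⟩, l, hl, hne⟩
  · exact hR y _ _ h
  · exact h0 l (by simpa using h)

end Subquotients

/-! ### Multiplicities -/

section Multiplicities

set_option linter.unusedSectionVars false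

variable {𝔨 : Type*} [LieRing 𝔨] [LieAlgebra ℂ 𝔨]

variable {L X Y : Type*}
  [AddCommGroup L] [Module ℂ L] [LieRingModule 𝔨 L] [LieModule ℂ 𝔨 L]
  [AddCommGroup X] [Module ℂ X] [LieRingModule 𝔨 X] [LieModule ℂ 𝔨 X]
  [AddCommGroup Y] [Module ℂ Y] [LieRingModule 𝔨 Y] [LieModule ℂ 𝔨 Y]

theorem occurs_self [Nontrivial L] : Occurs 𝔨 L L := by
  obtain ⟨l, hl⟩ := exists_ne (0 : L)
  refine ⟨LinearMap.ker (LinearMap.fst ℂ L L - LinearMap.snd ℂ L L), fun y x l h => ?_,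
    fun l h => ?_, l, l, by simp, hl⟩
  · have h' : x = l := sub_eq_zero.1 h
    subst h'
    exact sub_self _
  · exact (sub_eq_zero.1 (show (0 : L) - l = 0 from h)).symm

theorem Occurs.of_finMult_ne_zero [Nontrivial L] (h : finMult 𝔨 X L ≠ 0) : Occurs 𝔨 L X := by
  have h1 : ∃ s : {s : CompositionSeries (LieSubmodule ℂ 𝔨 X) // s.head = ⊥ ∧ s.last = ⊤},
      factorCount 𝔨 s.1 L ≠ 0 := by
    by_contra hc
    push Not at hc
    exact h (by simp [finMult, hc])
  obtain ⟨⟨s, _⟩, hs⟩ := h1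
  obtain ⟨i, ⟨e⟩⟩ := Set.encard_ne_zero.1 hs
  exact Occurs.of_submodule ((occurs_self.of_injective e.toLieModuleHom e.injective).of_surjective
    (LieSubmodule.Quotient.mk' _) (LieSubmodule.Quotient.surjective_mk' _))

theorem Occurs.of_mult_ne_zero [Nontrivial L] (h : mult 𝔨 X L ≠ 0) : Occurs 𝔨 L X := by
  have h1 : ∃ F : {F : LieSubmodule ℂ 𝔨 X // FiniteDimensional ℂ F}, finMult 𝔨 F.1 L ≠ 0 := by
    by_contra hc
    push Not at hc
    exact h (by simp [mult, hc])
  obtain ⟨F, hF⟩ := h1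
  exact (Occurs.of_finMult_ne_zero hF).of_submodule

/-- The first isomorphism theorem for Lie modules. -/
theorem nonempty_equiv_quotient (f : X →ₗ⁅ℂ,𝔨⁆ L) (hf : Function.Surjective f)
    (K : LieSubmodule ℂ 𝔨 X) (hK : ∀ x, x ∈ K ↔ f x = 0) : Nonempty (L ≃ₗ⁅ℂ,𝔨⁆ X ⧸ K) := by
  let E : (X ⧸ K.toSubmodule) ≃ₗ[ℂ] L :=
    (Submodule.quotEquivOfEq K.toSubmodule (LinearMap.ker (f : X →ₗ[ℂ] L))
      (Submodule.ext hK)).trans ((f : X →ₗ[ℂ] L).quotKerEquivOfSurjective hf)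
  have hE : ∀ x, E (Submodule.Quotient.mk x) = f x := fun x => rfl
  let E' : (X ⧸ K) ≃ₗ⁅ℂ,𝔨⁆ L :=
    { E with
      map_lie' := by
        intro y q
        obtain ⟨x, rfl⟩ := LieSubmodule.Quotient.surjective_mk' K q
        exact f.map_lie y x }
  exact ⟨E'.symm⟩

/-- In a finite dimensional module, every pair of neighbouring submodules is part of a composition
series. -/
theorem exists_compositionSeries_of_covBy [FiniteDimensional ℂ X] {K B : LieSubmodule ℂ 𝔨 X}
    (h : K ⋖ B) : ∃ s : CompositionSeries (LieSubmodule ℂ 𝔨 X), s.head = ⊥ ∧ s.last = ⊤ ∧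
      ∃ i : Fin s.length, s i.castSucc = K ∧ s i.succ = B := by
  have := LieSubmodule.wellFoundedLT_of_isArtinian ℂ 𝔨 X
  let u : LTSeries (LieSubmodule ℂ 𝔨 X) :=
    ⟨1, ![K, B], fun i => by
      obtain rfl : i = 0 := Subsingleton.elim _ _
      exact h.lt⟩
  obtain ⟨s, j, hj, hbot, htop⟩ := u.exists_relSeries_covBy_and_head_eq_bot_and_last_eq_bot
  let s' : CompositionSeries (LieSubmodule ℂ 𝔨 X) := s
  have hK : s' (j 0) = K := congrFun hj 0
  have hB : s' (j 1) = B := congrFun hj 1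
  have hlt : j 0 < j 1 := s'.strictMono.lt_iff_lt.1 (by rw [hK, hB]; exact h.lt)
  have hlen : (j 0 : ℕ) < s'.length := lt_of_lt_of_le hlt (Nat.lt_succ_iff.1 (j 1).2)
  let i : Fin s'.length := ⟨j 0, hlen⟩
  have hi : s' i.castSucc = K := hK
  refine ⟨s', hbot, htop, i, hi, ?_⟩
  -- The successor of `K` in the refined series lies strictly above `K` and at most at `B`; as `B`
  -- covers `K`, it is `B`.
  have h1 : s' i.castSucc < s' i.succ := s'.lt_succ i
  have h2 : s' i.succ ≤ s' (j 1) := s'.strictMono.monotone (Fin.le_def.2 hlt)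
  rw [hi] at h1
  rw [hB] at h2
  exact (h.eq_or_eq h1.le h2).resolve_left h1.ne'

/-- The relation `R` is the graph of a homomorphism with domain `B` and kernel `K`. Simplicity of
`L` makes it surjective and makes `B` cover `K`, so a composition series through `K` and `B` has the
factor `B/K ≅ L`. -/
theorem Occurs.finMult_ne_zero [FiniteDimensional ℂ X] [LieModule.IsIrreducible ℂ 𝔨 L]
    (h : Occurs 𝔨 L X) : finMult 𝔨 X L ≠ 0 := by
  obtain ⟨R, hR, h0, x₀, l₀, hl₀, hne⟩ := h
  have huniq : ∀ {x l l'}, (x, l) ∈ R → (x, l') ∈ R → l = l' := fun {x l l'} h h' =>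
    sub_eq_zero.1 (h0 _ (by simpa using R.sub_mem h h'))
  let B : LieSubmodule ℂ 𝔨 X :=
    { R.map (LinearMap.fst ℂ X L) with
      lie_mem := by
        rintro y _ ⟨⟨x, l⟩, h, rfl⟩
        exact ⟨(⁅y, x⁆, ⁅y, l⁆), hR y x l h, rfl⟩ }
  have hBmem : ∀ x, x ∈ B ↔ ∃ l, (x, l) ∈ R := fun x =>
    ⟨by rintro ⟨⟨x, l⟩, h, rfl⟩; exact ⟨l, h⟩, fun ⟨l, h⟩ => ⟨(x, l), h, rfl⟩⟩
  let K : LieSubmodule ℂ 𝔨 X :=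
    { R.comap (LinearMap.inl ℂ X L) with
      lie_mem := by
        intro y x h
        have := hR y x 0 h
        rwa [lie_zero] at this }
  have hKmem : ∀ x, x ∈ K ↔ (x, (0 : L)) ∈ R := fun x => Iff.rfl
  -- the image in `L` of a submodule of `B`
  let im (C : LieSubmodule ℂ 𝔨 X) : LieSubmodule ℂ 𝔨 L :=
    { (R ⊓ C.toSubmodule.comap (LinearMap.fst ℂ X L)).map (LinearMap.snd ℂ X L) with
      lie_mem := by
        rintro y _ ⟨⟨x, l⟩, ⟨h, hx⟩, rfl⟩
        exact ⟨(⁅y, x⁆, ⁅y, l⁆), ⟨hR y x l h, C.lie_mem hx⟩, rfl⟩ }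
  have himmem : ∀ C l, l ∈ im C ↔ ∃ x ∈ C, (x, l) ∈ R := fun C l =>
    ⟨by rintro ⟨⟨x, l⟩, ⟨h, hx⟩, rfl⟩; exact ⟨x, hx, h⟩,
      fun ⟨x, hx, h⟩ => ⟨(x, l), ⟨h, hx⟩, rfl⟩⟩
  have hKB : K ⋖ B := by
    refine ⟨lt_of_le_of_ne (fun x hx => (hBmem x).2 ⟨0, hx⟩) ?_, ?_⟩
    · intro he
      have : x₀ ∈ K := he ▸ (hBmem x₀).2 ⟨l₀, hl₀⟩
      exact hne (huniq hl₀ this)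
    · intro C hKC hCB
      -- The image of `C` in the simple module `L` is zero, forcing `C ≤ K`, or everything, forcing
      -- `B ≤ C`.
      rcases eq_bot_or_eq_top (im C) with hb | ht
      · refine hKC.not_ge fun x hx => ?_
        obtain ⟨l, hl⟩ := (hBmem x).1 (hCB.le hx)
        have : l ∈ im C := (himmem C l).2 ⟨x, hx, hl⟩
        rw [hb, LieSubmodule.mem_bot] at this
        subst this
        exact hl
      · refine hCB.not_ge fun x hx => ?_
        obtain ⟨l, hl⟩ := (hBmem x).1 hx
        obtain ⟨c, hc, hcl⟩ := (himmem C l).1 (by rw [ht]; trivial)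
        have : x - c ∈ K := by simpa [hKmem] using R.sub_mem hl hcl
        simpa using C.add_mem (hKC.le this) hc
  obtain ⟨s, hbot, htop, i, hiK, hiB⟩ := exists_compositionSeries_of_covBy hKB
  choose f hf using fun b : B => (hBmem b.1).1 b.2
  let F : B →ₗ⁅ℂ,𝔨⁆ L :=
    { toFun := f
      map_add' := fun a b => huniq (hf (a + b)) (R.add_mem (hf a) (hf b))
      map_smul' := fun c a => huniq (hf (c • a)) (R.smul_mem c (hf a))
      map_lie' := fun {y a} => huniq (hf ⁅y, a⁆) (hR y _ _ (hf a)) }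
  have hsurj : Function.Surjective F := by
    have ht : im B = ⊤ := (eq_bot_or_eq_top (im B)).resolve_left fun hb => hne <| by
      have : l₀ ∈ im B := (himmem B l₀).2 ⟨x₀, (hBmem x₀).2 ⟨l₀, hl₀⟩, hl₀⟩
      rwa [hb, LieSubmodule.mem_bot] at this
    intro l
    obtain ⟨x, hx, hl⟩ := (himmem B l).1 (by rw [ht]; trivial)
    exact ⟨⟨x, hx⟩, huniq (hf ⟨x, hx⟩) hl⟩
  have hiso : Nonempty (L ≃ₗ⁅ℂ,𝔨⁆ B ⧸ K.comap B.incl) := by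
    refine nonempty_equiv_quotient F hsurj _ fun b => ?_
    refine ⟨fun hb => huniq (hf b) hb, fun hb => ?_⟩
    have := hf b
    rw [show f b = 0 from hb] at this
    exact this
  have hcount : factorCount 𝔨 s L ≠ 0 := by
    refine Set.encard_ne_zero.2 ⟨i, ?_⟩
    rw [← hiK, ← hiB] at hiso
    exact hiso
  intro hz
  refine hcount (le_antisymm (le_of_le_of_eq ?_ hz) zero_le)
  exact le_iSup (fun s : {s : CompositionSeries (LieSubmodule ℂ 𝔨 X) // s.head = ⊥ ∧ s.last = ⊤} =>
    factorCount 𝔨 s.1 L) ⟨s, hbot, htop⟩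

/-- Local finiteness in terms of submodules. -/
theorem IsLocallyFinite.exists_mem (h : IsLocallyFinite 𝔨 X) (x : X) :
    ∃ F : LieSubmodule ℂ 𝔨 X, FiniteDimensional ℂ F ∧ x ∈ F := by
  let F : LieSubmodule ℂ 𝔨 X :=
    { envOrbit 𝔨 x with
      lie_mem := by
        rintro y _ ⟨u, rfl⟩
        refine ⟨UniversalEnvelopingAlgebra.ι ℂ y * u, ?_⟩
        simp [envAct] }
  exact ⟨F, h x, 1, by simp⟩

theorem Occurs.mult_ne_zero [LieModule.IsIrreducible ℂ 𝔨 L]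
    (hX : ∀ x : X, ∃ F : LieSubmodule ℂ 𝔨 X, FiniteDimensional ℂ F ∧ x ∈ F)
    (h : Occurs 𝔨 L X) : mult 𝔨 X L ≠ 0 := by
  obtain ⟨F, hF, hL⟩ := h.exists_of_cover hX
  intro hz
  refine hL.finMult_ne_zero (le_antisymm (le_of_le_of_eq ?_ hz) zero_le)
  exact le_iSup (fun F : {F : LieSubmodule ℂ 𝔨 X // FiniteDimensional ℂ F} => finMult 𝔨 F.1 L)
    ⟨F, hF⟩

/-- Every finite dimensional module has a copy in `Type`. -/
theorem exists_equiv_type [FiniteDimensional ℂ X] :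
    ∃ (Y : Type) (_ : AddCommGroup Y) (_ : Module ℂ Y) (_ : LieRingModule 𝔨 Y)
      (_ : LieModule ℂ 𝔨 Y), FiniteDimensional ℂ Y ∧ Nonempty (X ≃ₗ⁅ℂ,𝔨⁆ Y) := by
  let e : X ≃ₗ[ℂ] (Fin (Module.finrank ℂ X) → ℂ) := (Module.finBasis ℂ X).equivFun
  let i₁ : LieRingModule 𝔨 (Fin (Module.finrank ℂ X) → ℂ) :=
    { bracket := fun y v => e ⁅y, e.symm v⁆
      add_lie := fun y z v => by
        change e _ = e _ + e _
        rw [add_lie, map_add]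
      lie_add := fun y v w => by
        change e _ = e _ + e _
        rw [map_add, lie_add, map_add]
      leibniz_lie := fun y z v => by
        change e ⁅y, e.symm (e _)⁆ = e _ + e ⁅z, e.symm (e _)⁆
        rw [e.symm_apply_apply, e.symm_apply_apply, leibniz_lie, map_add] }
  let i₂ : LieModule ℂ 𝔨 (Fin (Module.finrank ℂ X) → ℂ) :=
    { smul_lie := fun c y v => by
        change e _ = c • e _
        rw [smul_lie, map_smul]
      lie_smul := fun c y v => by
        change e _ = c • e _
        rw [map_smul, lie_smul, map_smul] }
  refine ⟨_, _, _, i₁, i₂, inferInstance, ⟨{ e with map_lie' := ?_ }⟩⟩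
  intro y x
  change e _ = e ⁅y, e.symm (e x)⁆
  rw [e.symm_apply_apply]

theorem isIrreducible_congr (e : X ≃ₗ⁅ℂ,𝔨⁆ Y) [LieModule.IsIrreducible ℂ 𝔨 X] :
    LieModule.IsIrreducible ℂ 𝔨 Y :=
  (LieSubmodule.orderIsoMapComap e).symm.isSimpleOrder

theorem exists_simpleFD_equiv [FiniteDimensional ℂ X] [LieModule.IsIrreducible ℂ 𝔨 X] :
    ∃ S : SimpleFD 𝔨, Nonempty (X ≃ₗ⁅ℂ,𝔨⁆ S.carrier) := by
  obtain ⟨Y, _, _, _, _, _, ⟨e⟩⟩ := exists_equiv_type (𝔨 := 𝔨) (X := X)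
  have := isIrreducible_congr e
  exact ⟨⟨Y⟩, ⟨e⟩⟩

instance SimpleFD.nontrivial (S : SimpleFD 𝔨) : Nontrivial S.carrier :=
  LieModule.nontrivial_of_isIrreducible ℂ 𝔨 S.carrier

/-- A nonzero finite dimensional module has a simple submodule. -/
theorem exists_simpleFD_injective [FiniteDimensional ℂ X] [Nontrivial X] :
    ∃ (S : SimpleFD 𝔨) (f : S.carrier →ₗ⁅ℂ,𝔨⁆ X), Function.Injective f := by
  have : Nontrivial (LieSubmodule ℂ 𝔨 X) := (LieSubmodule.nontrivial_iff ℂ 𝔨 X).2 inferInstance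
  -- Finite dimension makes the submodule lattice atomic; an atom is a simple submodule.
  obtain ⟨A, hA, -⟩ := (eq_bot_or_exists_atom_le (⊤ : LieSubmodule ℂ 𝔨 X)).resolve_left top_ne_bot
  have : Nontrivial A := (LieSubmodule.nontrivial_iff_ne_bot ℂ 𝔨 X).2 hA.1
  have : LieModule.IsIrreducible ℂ 𝔨 A := by
    refine LieModule.IsIrreducible.mk fun N hN => ?_
    have h1 : N.map A.incl ≤ A := by
      rintro _ ⟨a, -, rfl⟩
      exact a.2
    rcases hA.le_iff.1 h1 with h | h
    · refine absurd ((LieSubmodule.eq_bot_iff N).2 fun a ha => ?_) hN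
      have : (a : X) ∈ N.map A.incl := ⟨a, ha, rfl⟩
      rw [h, LieSubmodule.mem_bot] at this
      exact Subtype.ext this
    · refine eq_top_iff.2 fun a _ => ?_
      have : (a : X) ∈ N.map A.incl := by
        rw [h]
        exact a.2
      obtain ⟨b, hb, hba⟩ := this
      rwa [show a = b from Subtype.ext hba.symm]
  obtain ⟨S, ⟨e⟩⟩ := exists_simpleFD_equiv (𝔨 := 𝔨) (X := A)
  exact ⟨S, A.incl.comp e.symm.toLieModuleHom, Subtype.val_injective.comp e.symm.injective⟩

end Multiplicities

/-! ### Largest submodules with factors in a given set -/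

section Components

set_option linter.unusedSectionVars false

variable {𝔨 : Type*} [LieRing 𝔨] [LieAlgebra ℂ 𝔨]

/-- All simple finite dimensional subquotients of `X` belong to `S`. -/
def AllIn (S : Set (Irr 𝔨)) (X : Type*) [AddCommGroup X] [Module ℂ X] [LieRingModule 𝔨 X] : Prop :=
  ∀ L : SimpleFD 𝔨, Occurs 𝔨 L.carrier X → L.cls ∈ S

variable {S T : Set (Irr 𝔨)} {X Y : Type*}
  [AddCommGroup X] [Module ℂ X] [LieRingModule 𝔨 X] [LieModule ℂ 𝔨 X]
  [AddCommGroup Y] [Module ℂ Y] [LieRingModule 𝔨 Y] [LieModule ℂ 𝔨 Y]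

theorem AllIn.of_injective (g : X →ₗ⁅ℂ,𝔨⁆ Y) (hg : Function.Injective g) (h : AllIn S Y) :
    AllIn S X :=
  fun L hL => h L (hL.of_injective g hg)

theorem AllIn.of_surjective (g : X →ₗ⁅ℂ,𝔨⁆ Y) (hg : Function.Surjective g) (h : AllIn S X) :
    AllIn S Y :=
  fun L hL => h L (hL.of_surjective g hg)

theorem AllIn.mono (hST : S ⊆ T) (h : AllIn S X) : AllIn T X :=
  fun L hL => hST (h L hL)

theorem AllIn.range (g : X →ₗ⁅ℂ,𝔨⁆ Y) (h : AllIn S X) : AllIn S g.range :=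
  h.of_surjective (g.codRestrict g.range fun x => (LieModuleHom.mem_range _ _).2 ⟨x, rfl⟩)
    fun y => by
      obtain ⟨x, hx⟩ := (LieModuleHom.mem_range _ _).1 y.2
      exact ⟨x, Subtype.ext hx⟩

variable (S X) in
/-- The sum of all submodules of `X` with all simple subquotients in `S`. -/
def maxSub : LieSubmodule ℂ 𝔨 X where
  carrier := {x | ∃ F : LieSubmodule ℂ 𝔨 X, AllIn S F ∧ x ∈ F}
  zero_mem' := ⟨⊥, fun _ hL => absurd hL not_occurs_of_subsingleton, zero_mem _⟩
  add_mem' := by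
    rintro x y ⟨A, hA, hx⟩ ⟨B, hB, hy⟩
    exact ⟨A ⊔ B, fun L hL => hL.of_sup.elim (hA L) (hB L),
      add_mem ((le_sup_left : A ≤ A ⊔ B) hx) ((le_sup_right : B ≤ A ⊔ B) hy)⟩
  smul_mem' := by
    rintro c x ⟨A, hA, hx⟩
    exact ⟨A, hA, A.smul_mem c hx⟩
  lie_mem := by
    rintro y x ⟨A, hA, hx⟩
    exact ⟨A, hA, A.lie_mem hx⟩

theorem le_maxSub {F : LieSubmodule ℂ 𝔨 X} (h : AllIn S F) : F ≤ maxSub S X :=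
  fun _ hx => ⟨F, h, hx⟩

/-- An occurrence is already visible on one of the submodules that make up `maxSub`, because these
cover it elementwise. -/
theorem allIn_maxSub : AllIn S (maxSub S X) := by
  intro L hL
  obtain ⟨F, hF, hLF⟩ := hL.exists_of_cover (p := fun F => AllIn S F) fun x => by
    obtain ⟨A, hA, hx⟩ := x.2
    refine ⟨A.comap (maxSub S X).incl, ?_, hx⟩
    refine hA.of_injective (((maxSub S X).incl.comp (A.comap (maxSub S X).incl).incl).codRestrict A
      fun m => m.2) fun a b hab => ?_
    have h : ((a : maxSub S X) : X) = b := congrArg (fun z : A => (z : X)) hab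
    exact Subtype.ext (Subtype.ext h)
  exact hF L hLF

theorem maxSub_mono (hST : S ⊆ T) : maxSub S X ≤ maxSub T X :=
  le_maxSub (allIn_maxSub.mono hST)

theorem disjoint_maxSub
    (hX : ∀ x : X, ∃ F : LieSubmodule ℂ 𝔨 X, FiniteDimensional ℂ F ∧ x ∈ F) (hST : Disjoint S T) :
    Disjoint (maxSub S X) (maxSub T X) := by
  rw [disjoint_iff, LieSubmodule.eq_bot_iff]
  intro x hx
  by_contra hne
  obtain ⟨F, _, hxF⟩ := hX x
  -- Cutting down by `F` makes the intersection finite dimensional, which guarantees a simple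
  -- submodule.
  let A := F ⊓ (maxSub S X ⊓ maxSub T X)
  have : FiniteDimensional ℂ A :=
    Submodule.finiteDimensional_of_le (inf_le_left : A.toSubmodule ≤ F.toSubmodule)
  have : Nontrivial A := ⟨⟨⟨x, hxF, hx⟩, 0, fun h => hne (congrArg Subtype.val h)⟩⟩
  obtain ⟨L, f, hf⟩ := exists_simpleFD_injective (𝔨 := 𝔨) (X := A)
  have hL : Occurs 𝔨 L.carrier A := occurs_self.of_injective f hf
  exact Set.disjoint_left.1 hST
    (allIn_maxSub (S := S) (X := X) L (hL.mono (inf_le_right.trans inf_le_left)))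
    (allIn_maxSub (S := T) (X := X) L (hL.mono (inf_le_right.trans inf_le_right)))

end Components

/-! ### Decomposition into blocks -/

section BlockDecomposition

set_option linter.unusedSectionVars false

variable {𝔤 : Type*} [LieRing 𝔤] [LieAlgebra ℂ 𝔤] {𝔫 : LieSubalgebra ℂ 𝔤}

/-- The isomorphism classes in a block. -/
def blockSet (I : Block 𝔫) : Set (Irr 𝔫) := {c | Quotient.mk (blockSetoid 𝔫) c = I}

theorem disjoint_blockSet {I J : Block 𝔫} (h : I ≠ J) : Disjoint (blockSet I) (blockSet J) :=
  Set.disjoint_left.2 fun _ hI hJ => h (hI.symm.trans hJ)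

theorem belongs_iff {L : Type*} [AddCommGroup L] [Module ℂ L] [LieRingModule 𝔫 L]
    [LieModule ℂ 𝔫 L] {S : SimpleFD 𝔫} (e : L ≃ₗ⁅ℂ,𝔫⁆ S.carrier) {I : Block 𝔫} :
    Belongs 𝔫 L I ↔ S.cls ∈ blockSet I := by
  refine ⟨fun ⟨S', ⟨e'⟩, h⟩ => ?_, fun h => ⟨S, ⟨e⟩, h⟩⟩
  have : S.cls = S'.cls := Quotient.sound ⟨e.symm.trans e'⟩
  rwa [this]

theorem hasFactorsIn_iff {N : Type} [AddCommGroup N] [Module ℂ N] [LieRingModule 𝔫 N]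
    [LieModule ℂ 𝔫 N] {I : Block 𝔫} :
    HasFactorsIn 𝔫 N I ↔ FiniteDimensional ℂ N ∧ AllIn (blockSet I) N := by
  refine and_congr_right fun _ => forall_congr' fun L => ?_
  rw [belongs_iff (LieModuleEquiv.refl : L.carrier ≃ₗ⁅ℂ,𝔫⁆ L.carrier)]
  exact ⟨fun h hL => h hL.finMult_ne_zero, fun h hL => h (Occurs.of_finMult_ne_zero hL)⟩

theorem mk_cls_eq_of_linked {L S : SimpleFD 𝔫}
    (h : ShareIndecomposable 𝔫 L S ∨ OccursInTensor 𝔫 L S) :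
    Quotient.mk (blockSetoid 𝔫) L.cls = Quotient.mk (blockSetoid 𝔫) S.cls :=
  Quotient.sound (Relation.EqvGen.rel _ _ ⟨L, S, rfl, rfl, h⟩)

variable {X Y : Type*}
  [AddCommGroup X] [Module ℂ X] [LieRingModule 𝔫 X] [LieModule ℂ 𝔫 X]
  [AddCommGroup Y] [Module ℂ Y] [LieRingModule 𝔫 Y] [LieModule ℂ 𝔫 Y]

theorem IsIndecomposable.congr (e : X ≃ₗ⁅ℂ,𝔫⁆ Y) (h : IsIndecomposable 𝔫 X) :
    IsIndecomposable 𝔫 Y := by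
  obtain ⟨_, h⟩ := h
  refine ⟨e.injective.nontrivial, fun A B hAB => ?_⟩
  let o := (LieSubmodule.orderIsoMapComap e).symm
  refine (h (o A) (o B) (o.isCompl hAB)).imp (fun h => ?_) fun h => ?_ <;>
  · rwa [map_eq_bot_iff] at h

/-- Relation (I) links everything that occurs in `X` to one chosen simple submodule. Since (I)
quantifies over modules in `Type`, it is applied to a copy `Y` of `X`. -/
theorem exists_block_of_isIndecomposable [FiniteDimensional ℂ X] (h : IsIndecomposable 𝔫 X) :
    ∃ I : Block 𝔫, AllIn (blockSet I) X := by
  obtain ⟨Y, _, _, _, _, _, ⟨e⟩⟩ := exists_equiv_type (𝔨 := 𝔫) (X := X)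
  have hY := h.congr e
  have := hY.1
  obtain ⟨L, f, hf⟩ := exists_simpleFD_injective (𝔨 := 𝔫) (X := Y)
  refine ⟨Quotient.mk (blockSetoid 𝔫) L.cls, fun S hS => (mk_cls_eq_of_linked (Or.inl ?_)).symm⟩
  exact ⟨Y, _, _, _, _, inferInstance, hY,
    (occurs_self.of_injective f hf : Occurs 𝔫 L.carrier Y).finMult_ne_zero,
    (hS.of_injective e.toLieModuleHom e.injective).finMult_ne_zero⟩

/-- Induction on dimension: an indecomposable `F` lies in one block piece, and otherwise `F` is zero
or splits into two submodules of smaller dimension. -/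
theorem le_iSup_maxSub (n : ℕ) : ∀ F : LieSubmodule ℂ 𝔫 X, FiniteDimensional ℂ F →
    Module.finrank ℂ F = n → F ≤ ⨆ I : Block 𝔫, maxSub (blockSet I) X := by
  induction n using Nat.strong_induction_on with
  | _ n ih =>
    intro F _ hn
    by_cases hF : IsIndecomposable 𝔫 F
    · obtain ⟨I, hI⟩ := exists_block_of_isIndecomposable hF
      exact (le_maxSub hI).trans (le_iSup (fun I => maxSub (blockSet I) X) I)
    by_cases hF0 : F = ⊥
    · rw [hF0]
      exact bot_le
    have hnt : Nontrivial F := (LieSubmodule.nontrivial_iff_ne_bot ℂ 𝔫 X).2 hF0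
    have : ∃ A B : LieSubmodule ℂ 𝔫 F, IsCompl A B ∧ A ≠ ⊥ ∧ B ≠ ⊥ := by
      by_contra hc
      push Not at hc
      exact hF ⟨hnt, fun A B hAB => or_iff_not_imp_left.2 (hc A B hAB)⟩
    obtain ⟨A, B, hAB, hA, hB⟩ := this
    have key : ∀ A B : LieSubmodule ℂ 𝔫 F, IsCompl A B → B ≠ ⊥ →
        A.map F.incl ≤ ⨆ I : Block 𝔫, maxSub (blockSet I) X := by
      intro A B hAB hB
      have hlt : Module.finrank ℂ A < n := by
        rw [← hn]
        refine Submodule.finrank_lt fun h => hB ?_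
        have : A = ⊤ := LieSubmodule.toSubmodule_injective h
        rw [this] at hAB
        exact eq_bot_of_top_isCompl hAB
      let e := LieSubmodule.equivMapOfInjective A (f := F.incl) Subtype.val_injective
      exact ih _ hlt _ (Module.Finite.equiv e.toLinearEquiv) e.toLinearEquiv.finrank_eq.symm
    intro x hx
    obtain ⟨a, ha, b, hb, hab⟩ := (LieSubmodule.mem_sup A B _).1
      (hAB.sup_eq_top ▸ trivial : (⟨x, hx⟩ : F) ∈ A ⊔ B)
    have hx' : x = a + b := (congrArg Subtype.val hab).symm
    rw [hx']
    exact add_mem (key A B hAB hB ⟨a, ha, rfl⟩) (key B A hAB.symm hA ⟨b, hb, rfl⟩)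

theorem iSup_maxSub
    (hX : ∀ x : X, ∃ F : LieSubmodule ℂ 𝔫 X, FiniteDimensional ℂ F ∧ x ∈ F) :
    ⨆ I : Block 𝔫, maxSub (blockSet I) X = ⊤ := by
  refine eq_top_iff.2 fun x _ => ?_
  obtain ⟨F, hF, hx⟩ := hX x
  exact le_iSup_maxSub _ F hF rfl hx

theorem iSupIndep_maxSub
    (hX : ∀ x : X, ∃ F : LieSubmodule ℂ 𝔫 X, FiniteDimensional ℂ F ∧ x ∈ F) :
    iSupIndep fun I : Block 𝔫 => maxSub (blockSet I) X := by
  intro I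
  -- All other block pieces together lie in the `maxSub` of the complement of `blockSet I`, so
  -- independence reduces to one pair of disjoint sets.
  refine (disjoint_maxSub hX (disjoint_compl_right (a := blockSet I))).mono_right ?_
  exact iSup₂_le fun J hJ =>
    maxSub_mono fun _ hc hc' => Set.disjoint_left.1 (disjoint_blockSet hJ) hc hc'

end BlockDecomposition

/-! ### Stability under the big Lie algebra -/

section Stability

set_option linter.unusedSectionVars false

theorem exists_finiteDimensional_tensor {𝔨 : Type*} [LieRing 𝔨] [LieAlgebra ℂ 𝔨] {V F : Type*}
    [AddCommGroup V] [Module ℂ V] [LieRingModule 𝔨 V] [LieModule ℂ 𝔨 V]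
    [AddCommGroup F] [Module ℂ F] [LieRingModule 𝔨 F] [LieModule ℂ 𝔨 F] [FiniteDimensional ℂ F]
    (hV : IsLocallyFinite 𝔨 V) (t : V ⊗[ℂ] F) :
    ∃ G : LieSubmodule ℂ 𝔨 (V ⊗[ℂ] F), FiniteDimensional ℂ G ∧ t ∈ G := by
  induction t with
  | zero => exact ⟨⊥, inferInstanceAs (FiniteDimensional ℂ (⊥ : Submodule ℂ (V ⊗[ℂ] F))), zero_mem _⟩
  | tmul v f =>
    -- A pure tensor lies in the image of `W ⊗ F`, where `W` is a finite dimensional submodule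
    -- containing `v`.
    obtain ⟨W, _, hv⟩ := hV.exists_mem v
    let g : W ⊗[ℂ] F →ₗ⁅ℂ,𝔨⁆ V ⊗[ℂ] F := TensorProduct.LieModule.map W.incl LieModuleHom.id
    refine ⟨g.range, ?_, (LieModuleHom.mem_range _ _).2 ⟨⟨v, hv⟩ ⊗ₜ f, rfl⟩⟩
    have : g.range.toSubmodule = LinearMap.range (g : W ⊗[ℂ] F →ₗ[ℂ] V ⊗[ℂ] F) :=
      LieModuleHom.toSubmodule_range g
    change FiniteDimensional ℂ g.range.toSubmodule
    rw [this]
    infer_instance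
  | add s t hs ht =>
    obtain ⟨A, hA, hsA⟩ := hs
    obtain ⟨B, hB, htB⟩ := ht
    refine ⟨A ⊔ B, ?_, add_mem ((le_sup_left : A ≤ A ⊔ B) hsA) ((le_sup_right : B ≤ A ⊔ B) htB)⟩
    change FiniteDimensional ℂ (A ⊔ B).toSubmodule
    rw [LieSubmodule.sup_toSubmodule]
    have : FiniteDimensional ℂ A.toSubmodule := hA
    have : FiniteDimensional ℂ B.toSubmodule := hB
    infer_instance

variable {𝔤 : Type*} [LieRing 𝔤] [LieAlgebra ℂ 𝔤] {𝔫 : LieSubalgebra ℂ 𝔤}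

/-- Tensoring with `𝔤/𝔫` is right exact. For a simple submodule `S` of `F`, whatever occurs in `𝔤/𝔫
⊗ F` occurs in `𝔤/𝔫 ⊗ S`, where relation (II) applies, or in `𝔤/𝔫 ⊗ F/S`, where induction does. -/
theorem allIn_adjQuot_tensor (h𝔫 : IsLocallyFinite 𝔫 (AdjQuot 𝔫)) {I : Block 𝔫} (n : ℕ) :
    ∀ (F : Type*) [AddCommGroup F] [Module ℂ F] [LieRingModule 𝔫 F] [LieModule ℂ 𝔫 F]
      [FiniteDimensional ℂ F], Module.finrank ℂ F = n → AllIn (blockSet I) F →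
      AllIn (blockSet I) (AdjQuot 𝔫 ⊗[ℂ] F) := by
  induction n using Nat.strong_induction_on with
  | _ n ih =>
    intro F _ _ _ _ _ hn hF L hL
    rcases subsingleton_or_nontrivial F with hs | hnt
    · have : Subsingleton (AdjQuot 𝔫 ⊗[ℂ] F) := inferInstance
      exact absurd hL not_occurs_of_subsingleton
    obtain ⟨S, f, hf⟩ := exists_simpleFD_injective (𝔨 := 𝔫) (X := F)
    have hSF : Occurs 𝔫 S.carrier F := occurs_self.of_injective f hf
    let q := LieSubmodule.Quotient.mk' f.range
    have hexact : Function.Exact (f : S.carrier →ₗ[ℂ] F) (q : F →ₗ[ℂ] F ⧸ f.range) := fun x =>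
      (LieSubmodule.Quotient.mk_eq_zero f.range).trans (LieModuleHom.mem_range f x)
    have htensor := lTensor_exact (AdjQuot 𝔫) hexact (LieSubmodule.Quotient.surjective_mk' f.range)
    have hlt : Module.finrank ℂ (F ⧸ f.range) < n := by
      have h1 := Submodule.finrank_quotient_add_finrank f.range.toSubmodule
      have : Nontrivial f.range.toSubmodule := by
        obtain ⟨s, hs⟩ := exists_ne (0 : S.carrier)
        refine ⟨⟨⟨f s, (LieModuleHom.mem_range _ _).2 ⟨s, rfl⟩⟩, 0, fun h => hs (hf ?_)⟩⟩
        rw [map_zero]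
        exact congrArg Subtype.val h
      have h2 : 0 < Module.finrank ℂ f.range.toSubmodule := Module.finrank_pos
      change Module.finrank ℂ (F ⧸ f.range.toSubmodule) < n
      omega
    have : FiniteDimensional ℂ (F ⧸ f.range) :=
      inferInstanceAs (FiniteDimensional ℂ (F ⧸ f.range.toSubmodule))
    rcases hL.of_exact
      (TensorProduct.LieModule.map (LieModuleHom.id : AdjQuot 𝔫 →ₗ⁅ℂ,𝔫⁆ AdjQuot 𝔫) f)
      (TensorProduct.LieModule.map (LieModuleHom.id : AdjQuot 𝔫 →ₗ⁅ℂ,𝔫⁆ AdjQuot 𝔫) q)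
      (fun t ht => (htensor t).1 ht) with h | h
    · refine (mk_cls_eq_of_linked (Or.inr ?_)).symm.trans (hF S hSF)
      exact h.mult_ne_zero (exists_finiteDimensional_tensor h𝔫)
    · exact ih _ hlt (F ⧸ f.range) rfl
        (hF.of_surjective q (LieSubmodule.Quotient.surjective_mk' f.range)) L h

variable {M : Type*} [AddCommGroup M] [Module ℂ M] [LieRingModule 𝔤 M] [LieModule ℂ 𝔤 M]

/-- The action of `𝔤` induces a map from `𝔤/𝔫 ⊗ F` to `M/F` for every `𝔫`-submodule `F` of `M`. -/
def adjQuotAction (F : LieSubmodule ℂ 𝔫 M) : AdjQuot 𝔫 ⊗[ℂ] F →ₗ⁅ℂ,𝔫⁆ M ⧸ F :=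
  let β : 𝔤 →ₗ[ℂ] F →ₗ[ℂ] M ⧸ F :=
    LinearMap.mk₂ ℂ (fun x v => LieSubmodule.Quotient.mk' F ⁅x, (v : M)⁆)
      (fun x y v => by rw [add_lie, map_add])
      (fun c x v => by rw [smul_lie, map_smul])
      (fun x v w => by rw [Submodule.coe_add, lie_add, map_add])
      (fun c x v => by rw [Submodule.coe_smul, lie_smul, map_smul])
  let γ : AdjQuot 𝔫 →ₗ[ℂ] F →ₗ[ℂ] M ⧸ F :=
    Submodule.liftQ 𝔫.toLieSubmodule.toSubmodule β fun x hx => by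
      refine LinearMap.ext fun v => (LieSubmodule.Quotient.mk_eq_zero F).2 ?_
      -- Elements of `𝔫` preserve `F`, so they act as zero into `M/F`.
      exact F.lie_mem (x := (⟨x, hx⟩ : 𝔫)) v.2
  { TensorProduct.lift γ with
    map_lie' := by
      intro y t
      change TensorProduct.lift γ ⁅y, t⁆ = ⁅y, TensorProduct.lift γ t⁆
      induction t with
      | zero => simp
      | add s t hs ht => rw [lie_add, map_add, hs, ht, map_add, lie_add]
      | tmul a v =>
        obtain ⟨x, rfl⟩ := LieSubmodule.Quotient.surjective_mk' _ a
        rw [TensorProduct.LieModule.lie_tmul_right, map_add]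
        change LieSubmodule.Quotient.mk' F ⁅⁅(y : 𝔤), x⁆, (v : M)⁆
          + LieSubmodule.Quotient.mk' F ⁅x, ⁅(y : 𝔤), (v : M)⁆⁆
          = ⁅y, LieSubmodule.Quotient.mk' F ⁅x, (v : M)⁆⁆
        rw [← map_add, ← LieModuleHom.map_lie, LieSubalgebra.coe_bracket_of_module,
          leibniz_lie (y : 𝔤) x (v : M)] }

theorem adjQuotAction_tmul (F : LieSubmodule ℂ 𝔫 M) (x : 𝔤) (v : F) :
    adjQuotAction F (LieSubmodule.Quotient.mk' 𝔫.toLieSubmodule x ⊗ₜ v) =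
      LieSubmodule.Quotient.mk' F ⁅x, (v : M)⁆ :=
  rfl

theorem lie_mem_maxSub (h𝔫 : IsLocallyFinite 𝔫 (AdjQuot 𝔫)) (hM : IsLocallyFinite 𝔫 M)
    {I : Block 𝔫} (x : 𝔤) {m : M} (hm : m ∈ maxSub (blockSet I) M) :
    ⁅x, m⁆ ∈ maxSub (𝔨 := 𝔫) (blockSet I) M := by
  obtain ⟨E, _, hmE⟩ := hM.exists_mem m
  let F : LieSubmodule ℂ 𝔫 M := E ⊓ maxSub (blockSet I) M
  have hmF : m ∈ F := ⟨hmE, hm⟩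
  have : FiniteDimensional ℂ F :=
    Submodule.finiteDimensional_of_le (inf_le_left : F.toSubmodule ≤ E.toSubmodule)
  have hF : AllIn (blockSet I) F := fun L hL => allIn_maxSub (X := M) L (hL.mono inf_le_right)
  let q := LieSubmodule.Quotient.mk' F
  -- This is `F + 𝔤F`, an extension of a quotient of `𝔤/𝔫 ⊗ F` by `F`.
  let G := (adjQuotAction F).range.comap q
  have hFG : F ≤ G := fun v hv => by
    change q v ∈ (adjQuotAction F).range
    rw [(LieSubmodule.Quotient.mk_eq_zero F).2 hv]
    exact zero_mem _
  have hG : AllIn (blockSet I) G := by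
    intro L hL
    refine (hL.of_exact_range (LieSubmodule.inclusion hFG) (q.comp G.incl) (adjQuotAction F)
      (fun y hy => ⟨⟨y, (LieSubmodule.Quotient.mk_eq_zero F).1 hy⟩, rfl⟩)
      fun y => (LieModuleHom.mem_range _ _).1 y.2).elim (hF L) ?_
    exact allIn_adjQuot_tensor h𝔫 _ F rfl hF L
  refine le_maxSub hG ?_
  exact (LieModuleHom.mem_range _ _).2 ⟨_, adjQuotAction_tmul F x ⟨m, hmF⟩⟩

variable (𝔫 M) in
/-- The `𝔤`-submodule of `M` formed by the block `I`. -/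
def blockSubmodule (h𝔫 : IsLocallyFinite 𝔫 (AdjQuot 𝔫)) (hM : IsLocallyFinite 𝔫 M)
    (I : Block 𝔫) : LieSubmodule ℂ 𝔤 M :=
  { (maxSub (blockSet I) M : LieSubmodule ℂ 𝔫 M).toSubmodule with
    lie_mem := fun hm => lie_mem_maxSub h𝔫 hM _ hm }

end Stability

/-! ### The universal property of the induced module -/

section InducedModule

set_option linter.unusedSectionVars false

attribute [local instance 100] LieRing.ofAssociativeRing

/-- The universal enveloping algebra is generated by the Lie algebra. -/
theorem subalgebra_eq_top_of_ι_mem {𝔨 : Type*} [LieRing 𝔨] [LieAlgebra ℂ 𝔨]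
    (S : Subalgebra ℂ (UniversalEnvelopingAlgebra ℂ 𝔨))
    (h : ∀ x, UniversalEnvelopingAlgebra.ι ℂ x ∈ S) : S = ⊤ := by
  let j : 𝔨 →ₗ⁅ℂ⁆ S :=
    { toFun := fun x => ⟨UniversalEnvelopingAlgebra.ι ℂ x, h x⟩
      map_add' := fun x y => Subtype.ext (map_add _ x y)
      map_smul' := fun c x => Subtype.ext (map_smul _ c x)
      map_lie' := fun {x y} => Subtype.ext (LieHom.map_lie _ x y) }
  -- Lifting the corestricted `ι` gives a section of the inclusion of `S`: the composite fixes the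
  -- generators, hence is the identity.
  have hid : S.val.comp (UniversalEnvelopingAlgebra.lift ℂ j) = AlgHom.id ℂ (UniversalEnvelopingAlgebra ℂ 𝔨) := by
    apply UniversalEnvelopingAlgebra.hom_ext ℂ
    ext x
    simp [j]
  refine eq_top_iff.2 fun u _ => ?_
  have := DFunLike.congr_fun hid u
  rw [AlgHom.id_apply] at this
  rw [← this]
  exact (UniversalEnvelopingAlgebra.lift ℂ j u).2

variable {𝔤 : Type*} [LieRing 𝔤] [LieAlgebra ℂ 𝔤] {𝔫 : LieSubalgebra ℂ 𝔤}

variable {N M : Type*} [AddCommGroup N] [Module ℂ N] [LieRingModule 𝔫 N] [LieModule ℂ 𝔫 N]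
  [AddCommGroup M] [Module ℂ M] [LieRingModule 𝔤 M] [LieModule ℂ 𝔤 M]

theorem envAct_ι {𝔨 : Type*} [LieRing 𝔨] [LieAlgebra ℂ 𝔨] {V : Type*} [AddCommGroup V] [Module ℂ V]
    [LieRingModule 𝔨 V] [LieModule ℂ 𝔨 V] (x : 𝔨) (v : V) :
    envAct 𝔨 V (UniversalEnvelopingAlgebra.ι ℂ x) v = ⁅x, v⁆ := by
  simp [envAct]

theorem envIncl_ι (y : 𝔫) : envIncl 𝔫 (UniversalEnvelopingAlgebra.ι ℂ y) =
    UniversalEnvelopingAlgebra.ι ℂ (y : 𝔤) := by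
  simp [envIncl]

/-- The elements `w` satisfying the identity for all `v` form a subalgebra containing `𝔫`. This is
what makes the extension of `f` to the tensor product respect `balancedRel`. -/
theorem envAct_envIncl (f : N →ₗ⁅ℂ,𝔫⁆ M) (w : UniversalEnvelopingAlgebra ℂ 𝔫) (v : N) :
    envAct 𝔤 M (envIncl 𝔫 w) (f v) = f (envAct 𝔫 N w v) := by
  let S : Subalgebra ℂ (UniversalEnvelopingAlgebra ℂ 𝔫) :=
    { carrier := {w | ∀ v, envAct 𝔤 M (envIncl 𝔫 w) (f v) = f (envAct 𝔫 N w v)}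
      mul_mem' := fun {a b} ha hb v => by
        simp only [map_mul, Module.End.mul_apply]
        rw [hb, ha]
      add_mem' := fun {a b} ha hb v => by
        simp only [map_add, LinearMap.add_apply]
        rw [hb, ha]
      algebraMap_mem' := fun c v => by
        simp only [AlgHom.commutes, Module.algebraMap_end_apply, map_smul] }
  have hS : S = ⊤ := subalgebra_eq_top_of_ι_mem S fun y v => by
    rw [envIncl_ι, envAct_ι, envAct_ι, LieModuleHom.map_lie, LieSubalgebra.coe_bracket_of_module]
  exact (hS ▸ trivial : w ∈ S) v

variable (𝔫 N) in
/-- The canonical map `v ↦ 1 ⊗ v` from `N` to the induced module. -/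
def indMk : N →ₗ⁅ℂ,𝔫⁆ Ind 𝔫 N where
  toFun v := Submodule.Quotient.mk ((1 : UniversalEnvelopingAlgebra ℂ 𝔤) ⊗ₜ[ℂ] v)
  map_add' v w := by rw [TensorProduct.tmul_add, Submodule.Quotient.mk_add]
  map_smul' c v := by
    rw [TensorProduct.tmul_smul]
    rfl
  map_lie' {y v} := by
    have h := (Submodule.Quotient.mk_eq_zero (balancedRel 𝔫 N)).2 (Submodule.subset_span
      ⟨1, UniversalEnvelopingAlgebra.ι ℂ y, v, rfl⟩)
    rw [Submodule.Quotient.mk_sub, sub_eq_zero, envAct_ι, one_mul, envIncl_ι] at h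
    refine h.symm.trans ?_
    change _ = Submodule.Quotient.mk
      (UniversalEnvelopingAlgebra.ι ℂ (y : 𝔤) • ((1 : UniversalEnvelopingAlgebra ℂ 𝔤) ⊗ₜ[ℂ] v))
    rw [TensorProduct.smul_tmul', smul_eq_mul, mul_one]

theorem mk_tmul_eq_smul_indMk (u : UniversalEnvelopingAlgebra ℂ 𝔤) (v : N) :
    (Submodule.Quotient.mk (u ⊗ₜ[ℂ] v) : Ind 𝔫 N) = u • indMk 𝔫 N v := by
  change _ = Submodule.Quotient.mk (u • ((1 : UniversalEnvelopingAlgebra ℂ 𝔤) ⊗ₜ[ℂ] v))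
  rw [TensorProduct.smul_tmul', smul_eq_mul, mul_one]

/-- The induced module is generated by the image of `N`. -/
theorem eq_top_of_indMk_mem (Q : LieSubmodule ℂ 𝔤 (Ind 𝔫 N)) (hQ : ∀ v, indMk 𝔫 N v ∈ Q) :
    Q = ⊤ := by
  let S : Subalgebra ℂ (UniversalEnvelopingAlgebra ℂ 𝔤) :=
    { carrier := {u | ∀ m ∈ Q, u • m ∈ Q}
      mul_mem' := fun {a b} ha hb m hm => by
        rw [mul_smul]
        exact ha _ (hb m hm)
      add_mem' := fun {a b} ha hb m hm => by
        rw [add_smul]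
        exact add_mem (ha m hm) (hb m hm)
      algebraMap_mem' := fun c m hm => by
        rw [algebraMap_smul]
        exact Q.smul_mem c hm }
  have hS : S = ⊤ := subalgebra_eq_top_of_ι_mem S fun x m hm => Q.lie_mem (x := x) hm
  refine eq_top_iff.2 fun m _ => ?_
  obtain ⟨t, rfl⟩ := Submodule.Quotient.mk_surjective _ m
  induction t with
  | zero => exact zero_mem Q
  | add s t hs ht =>
    rw [Submodule.Quotient.mk_add]
    exact add_mem (hs trivial) (ht trivial)
  | tmul u v =>
    rw [mk_tmul_eq_smul_indMk]
    exact (hS ▸ trivial : u ∈ S) _ (hQ v)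

/-- An `𝔫`-homomorphism from `N` to a `𝔤`-module extends to the induced module. -/
theorem exists_ind_hom (f : N →ₗ⁅ℂ,𝔫⁆ M) :
    ∃ φ : Ind 𝔫 N →ₗ⁅ℂ,𝔤⁆ M, ∀ v, φ (indMk 𝔫 N v) = f v := by
  let T : UniversalEnvelopingAlgebra ℂ 𝔤 ⊗[ℂ] N →ₗ[ℂ] M :=
    TensorProduct.lift (LinearMap.mk₂ ℂ (fun u v => envAct 𝔤 M u (f v))
      (fun u u' v => by rw [map_add, LinearMap.add_apply])
      (fun c u v => by rw [map_smul, LinearMap.smul_apply])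
      (fun u v v' => by rw [map_add, map_add])
      (fun c u v => by rw [map_smul, map_smul]))
  have hT : ∀ u v, T (u ⊗ₜ v) = envAct 𝔤 M u (f v) := fun u v => rfl
  have hsmul : ∀ u t, T (u • t) = envAct 𝔤 M u (T t) := by
    intro u t
    induction t with
    | zero => simp
    | add s t hs ht => rw [smul_add, map_add, map_add, hs, ht, map_add]
    | tmul u' v =>
      rw [TensorProduct.smul_tmul', smul_eq_mul, hT, hT, map_mul, Module.End.mul_apply]
  have hker : (balancedRel 𝔫 N).restrictScalars ℂ ≤ LinearMap.ker T := by
    intro t ht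
    change t ∈ balancedRel 𝔫 N at ht
    rw [LinearMap.mem_ker]
    induction ht using Submodule.span_induction with
    | mem t h =>
      obtain ⟨u, w, v, rfl⟩ := h
      rw [map_sub, hT, hT, map_mul, Module.End.mul_apply, envAct_envIncl, sub_self]
    | zero => exact map_zero T
    | add s t _ _ hs ht => rw [map_add, hs, ht, add_zero]
    | smul u t _ ht => rw [hsmul, ht, map_zero]
  let φ : Ind 𝔫 N →ₗ[ℂ] M :=
    (Submodule.liftQ ((balancedRel 𝔫 N).restrictScalars ℂ) T hker).comp
      (Submodule.Quotient.restrictScalarsEquiv ℂ (balancedRel 𝔫 N)).symm.toLinearMap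
  have hφ : ∀ t, φ (Submodule.Quotient.mk t) = T t := fun t => rfl
  refine ⟨{ φ with map_lie' := ?_ }, fun v => ?_⟩
  · intro x m
    obtain ⟨t, rfl⟩ := Submodule.Quotient.mk_surjective _ m
    change φ (Submodule.Quotient.mk (UniversalEnvelopingAlgebra.ι ℂ x • t)) = ⁅x, φ _⁆
    rw [hφ, hφ, hsmul, envAct_ι]
  · change φ (Submodule.Quotient.mk _) = _
    rw [hφ, hT, map_one, Module.End.one_apply]

end InducedModule

/-! ### The traces -/

section Traces

variable {𝔤 : Type*} [LieRing 𝔤] [LieAlgebra ℂ 𝔤] {𝔫 : LieSubalgebra ℂ 𝔤}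
  {M : Type*} [AddCommGroup M] [Module ℂ M] [LieRingModule 𝔤 M] [LieModule ℂ 𝔤 M]
  (h𝔫 : IsLocallyFinite 𝔫 (AdjQuot 𝔫)) (hM : IsLocallyFinite 𝔫 M) (I : Block 𝔫)

/-- Frobenius reciprocity in both directions: the inclusion of a finite dimensional piece extends to
its induced module, while any map from an induced module is controlled by its restriction to the
generating copy of `N`. -/
theorem blockSubmodule_eq_traceSubspace :
    (blockSubmodule 𝔫 M h𝔫 hM I).toSubmodule = traceSubspace 𝔫 M I := by
  apply le_antisymm
  · intro m hm
    obtain ⟨E, _, hmE⟩ := hM.exists_mem m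
    let F : LieSubmodule ℂ 𝔫 M := E ⊓ maxSub (blockSet I) M
    have hmF : m ∈ F := ⟨hmE, hm⟩
    have : FiniteDimensional ℂ F :=
      Submodule.finiteDimensional_of_le (inf_le_left : F.toSubmodule ≤ E.toSubmodule)
    have hF : AllIn (blockSet I) F := fun L hL => allIn_maxSub (X := M) L (hL.mono inf_le_right)
    -- The trace ranges over modules in `Type`, so `F` is transported there.
    obtain ⟨N, i₁, i₂, i₃, i₄, _, ⟨e⟩⟩ := exists_equiv_type (𝔨 := 𝔫) (X := F)
    have hN : HasFactorsIn 𝔫 N I :=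
      hasFactorsIn_iff.2 ⟨inferInstance, hF.of_surjective e.toLieModuleHom e.surjective⟩
    obtain ⟨φ, hφ⟩ := exists_ind_hom (F.incl.comp e.symm.toLieModuleHom)
    refine Submodule.mem_iSup_of_mem N <| Submodule.mem_iSup_of_mem i₁ <|
      Submodule.mem_iSup_of_mem i₂ <| Submodule.mem_iSup_of_mem i₃ <|
      Submodule.mem_iSup_of_mem i₄ <| Submodule.mem_iSup_of_mem hN <|
      Submodule.mem_iSup_of_mem φ ⟨indMk 𝔫 N (e ⟨m, hmF⟩), (hφ _).trans ?_⟩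
    change ((e.symm (e ⟨m, hmF⟩) : F) : M) = m
    rw [LieModuleEquiv.symm_apply_apply]
  · refine iSup_le fun N => iSup_le fun i₁ => iSup_le fun i₂ => iSup_le fun i₃ =>
      iSup_le fun i₄ => iSup_le fun hN => iSup_le fun φ => ?_
    have hN := (hasFactorsIn_iff.1 hN).2
    let g : N →ₗ⁅ℂ,𝔫⁆ M := (φ.restrictLie 𝔫).comp (indMk 𝔫 N)
    -- The preimage of the block piece is a `𝔤`-submodule because the piece is `𝔤`-stable; it
    -- contains the generators, hence is everything.
    have htop := eq_top_of_indMk_mem ((blockSubmodule 𝔫 M h𝔫 hM I).comap φ) fun v =>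
      le_maxSub (hN.range g) ((LieModuleHom.mem_range g _).2 ⟨v, rfl⟩)
    rintro _ ⟨m, rfl⟩
    exact (htop ▸ trivial : m ∈ (blockSubmodule 𝔫 M h𝔫 hM I).comap φ)

theorem allIn_blockSubmodule : AllIn (blockSet I) (blockSubmodule 𝔫 M h𝔫 hM I) := by
  let j : blockSubmodule 𝔫 M h𝔫 hM I →ₗ⁅ℂ,𝔫⁆ (maxSub (blockSet I) M : LieSubmodule ℂ 𝔫 M) :=
    ((blockSubmodule 𝔫 M h𝔫 hM I).incl.restrictLie 𝔫).codRestrict _ fun m => m.2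
  refine allIn_maxSub.of_injective j fun a b hab => Subtype.ext ?_
  exact congrArg (fun z : (maxSub (blockSet I) M : LieSubmodule ℂ 𝔫 M) => (z : M)) hab

theorem hom_blockSubmodule_eq_zero {I J : Block 𝔫} (hIJ : I ≠ J)
    (f : blockSubmodule 𝔫 M h𝔫 hM I →ₗ⁅ℂ,𝔤⁆ blockSubmodule 𝔫 M h𝔫 hM J) : f = 0 := by
  let g : blockSubmodule 𝔫 M h𝔫 hM I →ₗ⁅ℂ,𝔫⁆ M :=
    ((blockSubmodule 𝔫 M h𝔫 hM J).incl.comp f).restrictLie 𝔫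
  refine LieModuleHom.ext fun m => Subtype.ext ?_
  have hI : g m ∈ maxSub (𝔨 := 𝔫) (blockSet I) M :=
    le_maxSub ((allIn_blockSubmodule h𝔫 hM I).range g) ((LieModuleHom.mem_range g _).2 ⟨m, rfl⟩)
  have hJ : g m ∈ maxSub (𝔨 := 𝔫) (blockSet J) M := (f m).2
  have := (disjoint_maxSub hM.exists_mem (disjoint_blockSet hIJ)).le_bot ⟨hI, hJ⟩
  exact (LieSubmodule.mem_bot _).1 this

end Traces

end LieBlocks

end

theorem theorem11 {𝔤 : Type*} [LieRing 𝔤] [LieAlgebra ℂ 𝔤] (𝔫 : LieSubalgebra ℂ 𝔤)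
    (h𝔫 : LieBlocks.IsLocallyFinite 𝔫 (LieBlocks.AdjQuot 𝔫))
    (M : Type*) [AddCommGroup M] [Module ℂ M] [LieRingModule 𝔤 M] [LieModule ℂ 𝔤 M]
    (hM : LieBlocks.IsLocallyFinite 𝔫 M)
    [DecidableEq (LieBlocks.Block 𝔫)] :
    ∃ P : LieBlocks.Block 𝔫 → LieSubmodule ℂ 𝔤 M,
      -- each `M_I` is a `𝔤`-submodule, namely `P I`, and its factors over `𝔫` lie in `I`
      (∀ I, (P I).toSubmodule = LieBlocks.traceSubspace 𝔫 M I) ∧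
      (∀ (I : LieBlocks.Block 𝔫) (L : Type*) [AddCommGroup L] [Module ℂ L] [LieRingModule 𝔫 L]
        [LieModule ℂ 𝔫 L] [FiniteDimensional ℂ L] [LieModule.IsIrreducible ℂ 𝔫 L],
        LieBlocks.mult 𝔫 (P I) L ≠ 0 → LieBlocks.Belongs 𝔫 L I) ∧
      -- `M` is the direct sum of the `M_I`
      DirectSum.IsInternal P ∧
      -- there are no nonzero homomorphisms between different summands
      (∀ I J : LieBlocks.Block 𝔫, I ≠ J → ∀ f : P I →ₗ⁅ℂ,𝔤⁆ P J, f = 0) := by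
  refine ⟨fun I => LieBlocks.blockSubmodule 𝔫 M h𝔫 hM I,
    LieBlocks.blockSubmodule_eq_traceSubspace h𝔫 hM, ?_, ?_,
    fun I J hIJ f => LieBlocks.hom_blockSubmodule_eq_zero h𝔫 hM hIJ f⟩
  · intro I L _ _ _ _ _ _ hL
    have := LieModule.nontrivial_of_isIrreducible ℂ 𝔫 L
    obtain ⟨S, ⟨e⟩⟩ := LieBlocks.exists_simpleFD_equiv (𝔨 := 𝔫) (X := L)
    exact (LieBlocks.belongs_iff e).2 (LieBlocks.allIn_blockSubmodule h𝔫 hM I S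
      ((LieBlocks.Occurs.of_mult_ne_zero hL).congr_left e))
  · have hind := LieSubmodule.iSupIndep_toSubmodule.2
      (LieBlocks.iSupIndep_maxSub (𝔫 := 𝔫) (X := M) hM.exists_mem)
    refine DirectSum.isInternal_submodule_of_iSupIndep_of_iSup_eq_top
      (A := fun I => (LieBlocks.blockSubmodule 𝔫 M h𝔫 hM I).toSubmodule) hind ?_
    have h := LieBlocks.iSup_maxSub (𝔫 := 𝔫) (X := M) hM.exists_mem
    rw [← LieSubmodule.toSubmodule_inj, LieSubmodule.iSup_toSubmodule] at h
    exact h
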